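/- All graphs are finite and simple. For a connected graph $G$ and a vertex $u$ let $e(u)=\max_{v}d(u,v)$ be its eccentricity, put $f(x,y)=\sqrt{\frac{x+y-2}{xy}}$, and let $ABC_3(G)=\sum_{uv\in E(G)}f(e(u),e(v))$. A graph is unicyclic if it is connected and contains exactly one cycle. For $k\ge 3$ and integers $n_1,\dots,n_k\ge 0$ with $n_1+\dots+n_k=n-k$, let $H(n,k;n_1,\dots,n_k)$ be the graph of order $n$ obtained from a cycle $v_1v_2\cdots v_k$ by attaching $n_i$ new pendant vertices to $v_i$ for every $i$. Lemma 2.5. Let $G$ be a unicyclic graph of order $n\ge 6$ and girth $k$ with $3\le k\le n-1$ (that is, $G$ is not a cycle). (a) If $k=3$, then $ABC_3(G)\le n\sqrt{\tfrac12}$, with equality if and only if $G\cong H(n,3;n_1,n_2,n_3)$ for some $n_1,n_2,n_3\ge 0$ with $n_1+n_2+n_3=n-3$. (b) If $k\ge 4$ is even, then $$ABC_3(G)\le (n-k+2)\,f\!\left(\tfrac k2+1,\tfrac k2\right)+(k-2)\,f\!\left(\tfrac k2,\tfrac k2\right),$$ with equality if and only if $G\cong H(n,k;n-k,0,\dots,0)$.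 (c) If $k\ge 5$ is odd, then $$ABC_3(G)\le (n-k+2)\,f\!\left(\tfrac{k+1}2,\tfrac{k-1}2\right)+(k-3)\,f\!\left(\tfrac{k-1}2,\tfrac{k-1}2\right)+f\!\left(\tfrac{k+1}2,\tfrac{k+1}2\right),$$ with equality if and only if $G\cong H(n,k;n-k,0,\dots,0)$. -/

import Mathlib

namespace ABCThree

/-- A unicyclic graph: a connected graph containing exactly one cycle. Cycles are identified with
their edge sets, so that the choice of base point and of orientation does not matter. -/
def IsUnicyclic {V : Type*} (G : SimpleGraph V) : Prop :=
  G.Connected ∧ ∃! s : Set (Sym2 V), ∃ (v : V) (p : G.Walk v v), p.IsCycle ∧ p.edgeSet = s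

/-- `f x y = √((x + y - 2) / (x y))`. -/
noncomputable def f (x y : ℝ) : ℝ := Real.sqrt ((x + y - 2) / (x * y))

theorem f_comm (x y : ℝ) : f x y = f y x := by
  unfold f
  rw [add_comm x y, mul_comm x y]

/-- The eccentricity of a vertex of a finite connected graph, as a natural number. -/
noncomputable def ecc {V : Type*} (G : SimpleGraph V) (u : V) : ℕ := (G.eccent u).toNat

/-- The contribution of an edge `uv` to the third atom-bond connectivity index. -/
noncomputable def edgeTerm {V : Type*} (G : SimpleGraph V) : Sym2 V → ℝ :=
  Sym2.lift ⟨fun u v => f (ecc G u) (ecc G v), fun _ _ => f_comm _ _⟩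

open Classical in
/-- The third atom-bond connectivity index: the sum over all edges `uv` of
`√((e(u) + e(v) - 2) / (e(u) e(v)))`. -/
noncomputable def ABC3 {V : Type*} [Fintype V] (G : SimpleGraph V) : ℝ :=
  ∑ e ∈ G.edgeFinset, edgeTerm G e

/-- The cycle on `k` vertices with `m i` new pendant vertices attached to its `i`-th vertex.
The vertex `Sum.inl i` is the `i`-th vertex of the cycle and `Sum.inr ⟨i, j⟩` is the `j`-th of
the new vertices attached to it. -/
def H (k : ℕ) (m : Fin k → ℕ) : SimpleGraph (Fin k ⊕ (Σ i : Fin k, Fin (m i))) where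
  Adj
    | .inl i, .inl j => (SimpleGraph.cycleGraph k).Adj i j
    | .inl i, .inr x => x.1 = i
    | .inr x, .inl i => x.1 = i
    | .inr _, .inr _ => False
  symm := by
    constructor
    rintro (i | x) (j | y) h
    · exact SimpleGraph.Adj.symm h
    · exact h
    · exact h
    · exact h
  loopless := by
    constructor
    rintro (i | x) h
    · exact SimpleGraph.irrefl _ h
    · exact h

/-- The sequence `(a, 0, …, 0)` of length `k`. -/
def allAtFirst (k a : ℕ) : Fin k → ℕ := fun i => if (i : ℕ) = 0 then a else 0

end ABCThree

/-! Deleting the edges of the cycle leaves a forest with exactly one cycle vertex in each tree.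
`SunDecomp` records this: `r v` is the index of the cycle vertex in the tree of `v`, and `h v` is
the distance of `v` from it. Every `v` has eccentricity at least `h v + k / 2`, and forces
eccentricity at least `h v + cycleDist k (r v) i` on `c i`.

Since `f` decreases in each argument on `[2, ∞)`, these bounds limit `ABC3` edge by edge when `k ≥
4`. Each of the `n - k` tree edges contributes at most `f (k/2 + 1) (k/2)`. If `c 0` is chosen to
carry a tree, the edge from `c i` to `c (i + 1)` contributes at most `f (cycleEcc k i) (cycleEcc k
(i + 1))`. Equality of the sums means equality in every term, which rules out heights above one and
pendant vertices away from `c 0`; see `SunDecomp.ABC3_eq_iff`.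

For `k = 3` eccentricity one can occur. Adjacent eccentricities differ by at most one, so every term
is at most `√(1/2)`, and it attains this exactly when an endpoint has eccentricity at most two; see
`f_le_sqrt_half`. -/

namespace ABCThree

open SimpleGraph

/-! ### Structure of unicyclic graphs: a cycle with trees attached. -/

section Decomposition

variable {V : Type*} {G : SimpleGraph V}

/-- The distance of the vertices `i` and `j` of a cycle of length `k`. -/
def cycleDist (k i j : ℕ) : ℕ := min ((i - j) + (j - i)) (k - ((i - j) + (j - i)))

/-- A decomposition of a graph into a cycle `c 0, …, c (k - 1)` with trees attached to it: the
vertex `v` belongs to the tree attached to `c (r v)`, and its height there is `h v`. -/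
structure SunDecomp (G : SimpleGraph V) (k : ℕ) (c : ℕ → V) (r h : V → ℕ) : Prop where
  three_le : 3 ≤ k
  closed : c k = c 0
  inj : ∀ i < k, ∀ j < k, c i = c j → i = j
  adj : ∀ i < k, G.Adj (c i) (c (i + 1))
  root_lt : ∀ v, r v < k
  root_cycle : ∀ i < k, r (c i) = i
  height_cycle : ∀ i < k, h (c i) = 0
  eq_of_height : ∀ v, h v = 0 → v = c (r v)
  edge : ∀ u v, G.Adj u v → (∃ i < k, s(u, v) = s(c i, c (i + 1))) ∨
    (r u = r v ∧ (h u = h v + 1 ∨ h v = h u + 1))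
  descend : ∀ v, h v ≠ 0 → ∃ w, G.Adj v w ∧ r w = r v ∧ h v = h w + 1

theorem IsUnicyclic.edgeSet_eq {G : SimpleGraph V} (hG : IsUnicyclic G) {x y : V}
    {p : G.Walk x x} {q : G.Walk y y} (hp : p.IsCycle) (hq : q.IsCycle) :
    q.edgeSet = p.edgeSet :=
  hG.2.unique ⟨y, q, hq, rfl⟩ ⟨x, p, hp, rfl⟩

theorem exists_getVert_of_mem_edges {x y u v : V} {p : G.Walk x y} (he : s(u, v) ∈ p.edges) :
    ∃ i < p.length, s(u, v) = s(p.getVert i, p.getVert (i + 1)) := by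
  rw [Walk.edges, List.mem_map] at he
  obtain ⟨d, hd, hde⟩ := he
  obtain ⟨i, hi, rfl⟩ := List.mem_iff_getElem.1 hd
  rw [Walk.darts_getElem_eq_getVert] at hde
  exact ⟨i, by simpa using hi, hde.symm⟩

theorem IsUnicyclic.isBridge {G : SimpleGraph V} (hG : IsUnicyclic G) {x u v : V}
    {p : G.Walk x x} (hp : p.IsCycle) (huv : G.Adj u v) (he : s(u, v) ∉ p.edges) :
    G.IsBridge s(u, v) := by
  rw [isBridge_iff_forall_cycle_notMem huv]
  intro y q hq hmem
  have h1 : s(u, v) ∈ q.edgeSet := hmem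
  rw [hG.edgeSet_eq hp hq] at h1
  exact he h1

theorem IsUnicyclic.isAcyclic_deleteEdges {G : SimpleGraph V} (hG : IsUnicyclic G) {x : V}
    {p : G.Walk x x} (hp : p.IsCycle) {s : Set (Sym2 V)} {e : Sym2 V} (he : e ∈ s)
    (hep : e ∈ p.edges) : (G.deleteEdges s).IsAcyclic := by
  intro y q hq
  have hq' := hq.mapLe (deleteEdges_le (G := G) s)
  have h1 : e ∈ (q.mapLe (deleteEdges_le s)).edgeSet := by
    rw [hG.edgeSet_eq hp hq']; exact hep
  rw [Walk.mem_edgeSet, Walk.edges_mapLe_eq_edges] at h1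
  have := q.edges_subset_edgeSet h1
  rw [edgeSet_deleteEdges] at this
  exact this.2 he

/-- Removing one edge of the cycle leaves a spanning tree. -/
theorem IsUnicyclic.card_edgeFinset [Fintype V] {G : SimpleGraph V} [Fintype G.edgeSet]
    (hG : IsUnicyclic G) : G.edgeFinset.card = Fintype.card V := by
  classical
  obtain ⟨-, x, p, hp, -⟩ := hG.2.exists
  have hl := hp.three_le_length
  have hadj : G.Adj (p.getVert 0) (p.getVert 1) := p.adj_getVert_succ (by omega)
  have hmem : s(p.getVert 0, p.getVert 1) ∈ p.edges := by
    rw [Walk.edges, List.mem_map]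
    have h0 : 0 < p.darts.length := by simp; omega
    exact ⟨p.darts[0], List.getElem_mem _, by rw [Walk.darts_getElem_eq_getVert]; rfl⟩
  have hcon : (G.deleteEdges {s(p.getVert 0, p.getVert 1)}).Connected :=
    hG.1.connected_delete_edge_of_not_isBridge fun hb => hb.notMem_edges_of_isCycle hp hmem
  have htree : (G.deleteEdges {s(p.getVert 0, p.getVert 1)}).IsTree :=
    ⟨hcon, hG.isAcyclic_deleteEdges hp rfl hmem⟩
  have hcard := htree.card_edgeFinset
  have : (G.deleteEdges {s(p.getVert 0, p.getVert 1)}).edgeFinset =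
      G.edgeFinset.erase s(p.getVert 0, p.getVert 1) := by
    ext e
    simp [edgeSet_deleteEdges, and_comm]
  rw [this, Finset.card_erase_of_mem (mem_edgeFinset.2 (G.mem_edgeSet.2 hadj))] at hcard
  have : 0 < G.edgeFinset.card := Finset.card_pos.2 ⟨_, mem_edgeFinset.2 (G.mem_edgeSet.2 hadj)⟩
  omega

theorem exists_walk_edges_subset {x u v : V} (p : G.Walk x x) (hu : u ∈ p.support)
    (hv : v ∈ p.support) : ∃ q : G.Walk u v, ∀ e ∈ q.edges, e ∈ p.edges := by
  classical
  refine ⟨(p.takeUntil u hu).reverse.append (p.takeUntil v hv), fun e he => ?_⟩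
  rw [Walk.edges_append, List.mem_append, Walk.edges_reverse, List.mem_reverse] at he
  rcases he with he | he
  · exact p.edges_takeUntil_subset_edges hu he
  · exact p.edges_takeUntil_subset_edges hv he

/-- Otherwise the first edge of a path between them off the cycle, which is a bridge, could be
bypassed along the cycle and back through the rest of the path. -/
theorem IsUnicyclic.eq_of_reachable_deleteEdges {G : SimpleGraph V} (hG : IsUnicyclic G)
    {x u v : V} {p : G.Walk x x} (hp : p.IsCycle) (hu : u ∈ p.support) (hv : v ∈ p.support)
    (h : (G.deleteEdges p.edgeSet).Reachable u v) : u = v := by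
  classical
  obtain ⟨q, hq⟩ := h.exists_isPath
  cases q with
  | nil => rfl
  | @cons _ w _ hadj q =>
    exfalso
    rw [deleteEdges_adj] at hadj
    obtain ⟨t, ht⟩ := exists_walk_edges_subset p hu hv
    have hb := isBridge_iff_forall_walk_mem_edges.1 (hG.isBridge hp hadj.1 hadj.2)
      (t.append (q.mapLe (deleteEdges_le _)).reverse)
    rw [Walk.edges_append, List.mem_append, Walk.edges_reverse, List.mem_reverse,
      Walk.edges_mapLe_eq_edges] at hb
    rcases hb with hb | hb
    · exact hadj.2 (ht _ hb)
    · rw [Walk.cons_isPath_iff] at hq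
      exact hq.2 (q.fst_mem_support_of_mem_edges hb)

theorem exists_reachable_deleteEdges (hG : G.Connected) {x : V} (p : G.Walk x x) (v : V) :
    ∃ u ∈ p.support, (G.deleteEdges p.edgeSet).Reachable v u := by
  suffices hs : ∀ y, G.Walk v y → y ∈ p.support →
      ∃ u ∈ p.support, (G.deleteEdges p.edgeSet).Reachable v u from
    hs x (hG.preconnected v x).some p.start_mem_support
  intro y q hy
  induction q with
  | nil => exact ⟨_, hy, .rfl⟩
  | @cons a b _ hadj q ih =>
    by_cases he : s(a, b) ∈ p.edges
    · exact ⟨a, p.fst_mem_support_of_mem_edges he, .rfl⟩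
    · obtain ⟨u, hu, hr⟩ := ih hy
      exact ⟨u, hu, (Adj.reachable (by rw [deleteEdges_adj]; exact ⟨hadj, he⟩)).trans hr⟩

theorem _root_.SimpleGraph.Reachable.exists_adj_dist_eq {F : SimpleGraph V} {v z : V}
    (hr : F.Reachable v z) (h0 : F.dist v z ≠ 0) :
    ∃ w, F.Adj v w ∧ F.Reachable w z ∧ F.dist v z = F.dist w z + 1 := by
  obtain ⟨q, hq⟩ := hr.exists_walk_length_eq_dist
  cases q with
  | nil => exact absurd dist_self h0
  | @cons _ w _ hadj t =>
    refine ⟨w, hadj, t.reachable, ?_⟩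
    rw [Walk.length_cons] at hq
    have h1 := dist_le t
    have h2 := hadj.reachable.dist_triangle_left z
    have h3 := dist_eq_one_iff_adj.2 hadj
    omega

theorem IsUnicyclic.sunDecomp_of_isCycle {G : SimpleGraph V} (hG : IsUnicyclic G) {x : V}
    {p : G.Walk x x} (hp : p.IsCycle) :
    ∃ r h : V → ℕ, SunDecomp G p.length p.getVert r h := by
  classical
  have hl := hp.three_le_length
  have hroot : ∀ v, ∃ i < p.length, (G.deleteEdges p.edgeSet).Reachable v (p.getVert i) := by
    intro v
    obtain ⟨u, hu, hr⟩ := exists_reachable_deleteEdges hG.1 p v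
    obtain ⟨i, rfl, hi⟩ := Walk.mem_support_iff_exists_getVert.1 hu
    rcases hi.lt_or_eq with hi | rfl
    · exact ⟨i, hi, hr⟩
    · exact ⟨0, by omega, by simpa using hr⟩
  have hinj : ∀ i < p.length, ∀ j < p.length, p.getVert i = p.getVert j → i = j :=
    fun i hi j hj hij => hp.getVert_injOn' (by simp; omega) (by simp; omega) hij
  choose r hr hreach using hroot
  have hrc : ∀ v, ∀ i < p.length, (G.deleteEdges p.edgeSet).Reachable v (p.getVert i) →
      r v = i := fun v i hi h => hinj _ (hr v) _ hi <|
    hG.eq_of_reachable_deleteEdges hp (p.getVert_mem_support _) (p.getVert_mem_support _)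
      ((hreach v).symm.trans h)
  have hac : (G.deleteEdges p.edgeSet).IsAcyclic := by
    have h0 : 0 < p.darts.length := by simp; omega
    have hmem : p.darts[0].edge ∈ p.edges := List.mem_map.2 ⟨_, List.getElem_mem _, rfl⟩
    exact hG.isAcyclic_deleteEdges hp (e := p.darts[0].edge) hmem hmem
  refine ⟨r, fun v => (G.deleteEdges p.edgeSet).dist v (p.getVert (r v)), hl, by simp, hinj,
    fun i hi => p.adj_getVert_succ hi, hr, fun i hi => hrc _ i hi .rfl, fun i hi => ?_,
    fun v hv => ?_, fun u v huv => ?_, fun v hv => ?_⟩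
  · rw [hrc _ i hi .rfl, dist_self]
  · exact (hreach v).dist_eq_zero_iff.1 hv
  · by_cases he : s(u, v) ∈ p.edges
    · exact .inl (exists_getVert_of_mem_edges he)
    · right
      have hadj : (G.deleteEdges p.edgeSet).Adj u v := by rw [deleteEdges_adj]; exact ⟨huv, he⟩
      have hruv : r u = r v := hrc u _ (hr v) (hadj.reachable.trans (hreach v))
      refine ⟨hruv, ?_⟩
      have := hac.dist_eq_dist_add_one_of_adj_of_reachable (p.getVert (r v)) hadj
        ((hreach v).symm.trans hadj.symm.reachable)
      simp only [hruv]
      rw [dist_comm, (G.deleteEdges p.edgeSet).dist_comm (u := v)]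
      exact this
  · obtain ⟨w, hadj, hw, hd⟩ := (hreach v).exists_adj_dist_eq hv
    have hrw : r w = r v := hrc w _ (hr v) hw
    exact ⟨w, (deleteEdges_adj.1 hadj).1, hrw, by simp only [hrw]; exact hd⟩

/-- As `k < n`, some edge leaves the cycle. Rotating the cycle to start at the foot of that edge
gives `r v = 0`, the normalisation used in all later bounds. -/
theorem IsUnicyclic.exists_sunDecomp [Fintype V] {G : SimpleGraph V} (hG : IsUnicyclic G) {k : ℕ}
    (hgirth : G.girth = k) (hk : k < Fintype.card V) :
    ∃ c r h, SunDecomp G k c r h ∧ ∃ v, h v ≠ 0 ∧ r v = 0 := by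
  classical
  have hnac : ¬ G.IsAcyclic := by
    obtain ⟨-, x, p, hp, -⟩ := hG.2.exists
    exact fun h => h p hp
  obtain ⟨x, p, hp, hlen⟩ := exists_girth_eq_length.2 hnac
  have hpk : p.length = k := hlen.symm.trans hgirth
  obtain ⟨z, hz⟩ : ∃ z, z ∉ p.support := by
    by_contra! hall
    have hsub : (Finset.univ : Finset V) ⊆ (Finset.range k).image p.getVert := by
      intro v _
      obtain ⟨i, rfl, hi⟩ := Walk.mem_support_iff_exists_getVert.1 (hall v)
      rw [Finset.mem_image]
      rcases hi.lt_or_eq with hi | rfl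
      · exact ⟨i, by simpa [hpk] using hi, rfl⟩
      · exact ⟨0, by have := hp.three_le_length; simp; omega, by simp⟩
    have := (Finset.card_le_card hsub).trans Finset.card_image_le
    rw [Finset.card_univ, Finset.card_range] at this
    omega
  obtain ⟨q⟩ := hG.1.preconnected x z
  obtain ⟨d, -, hd1, hd2⟩ := q.exists_boundary_dart {v | v ∈ p.support} p.start_mem_support hz
  have hd1 : d.fst ∈ p.support := hd1
  have hd2 : d.snd ∉ p.support := hd2
  have hcyc := hp.rotate hd1
  obtain ⟨r, h, hs⟩ := hG.sunDecomp_of_isCycle hcyc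
  have hlen' : (p.rotate _ hd1).length = k := by
    rw [← hpk]; exact p.length_rotate _ hd1
  have hsnd : ∀ i, d.snd ≠ (p.rotate _ hd1).getVert i := by
    intro i hi
    apply hd2
    rw [← Walk.mem_support_rotate_iff _ _ hd1, hi]
    exact Walk.getVert_mem_support _ _
  refine ⟨_, r, h, hlen' ▸ hs, d.snd, fun h0 => hsnd _ (hs.eq_of_height _ h0), ?_⟩
  have h3 := hs.three_le
  rcases hs.edge _ _ d.adj with ⟨i, hi, he⟩ | ⟨he, -⟩
  · rw [Sym2.eq_iff] at he
    rcases he with he | he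
    · exact absurd he.2 (hsnd _)
    · exact absurd he.2 (hsnd _)
  · rw [← he]
    have := hs.root_cycle 0 (by omega)
    rwa [Walk.getVert_zero] at this

end Decomposition

/-! ### Monotonicity of `f`. -/

/-- The square of `f x y` is `1/y + (1/x)(1 - 2/y)`: decreasing in `x` for `y > 2`, constant for `y
= 2`. -/
theorem f_le_f_left {x x' y : ℝ} (hx : 2 ≤ x) (hxx : x ≤ x') (hy : 2 ≤ y) : f x' y ≤ f x y := by
  refine Real.sqrt_le_sqrt ?_
  rw [div_le_div_iff₀ (by nlinarith) (by nlinarith)]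
  have : 0 ≤ y * ((x' - x) * (y - 2)) :=
    mul_nonneg (by linarith) (mul_nonneg (by linarith) (by linarith))
  linarith

theorem f_lt_f_left {x x' y : ℝ} (hx : 2 ≤ x) (hxx : x < x') (hy : 2 < y) : f x' y < f x y := by
  refine Real.sqrt_lt_sqrt (div_nonneg (by linarith) (by nlinarith)) ?_
  rw [div_lt_div_iff₀ (by nlinarith) (by nlinarith)]
  have : 0 < y * ((x' - x) * (y - 2)) :=
    mul_pos (by linarith) (mul_pos (by linarith) (by linarith))
  linarith

theorem f_le_f {x x' y y' : ℝ} (hx : 2 ≤ x) (hxx : x ≤ x') (hy : 2 ≤ y) (hyy : y ≤ y') :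
    f x' y' ≤ f x y :=
  (f_le_f_left hx hxx (hy.trans hyy)).trans <| by
    rw [f_comm x, f_comm x]; exact f_le_f_left hy hyy hx

/-- Strictness comes from moving `x` while the second argument is already `y'`, so only the larger
value `y'` has to exceed two. -/
theorem f_lt_f {x x' y y' : ℝ} (hx : 2 ≤ x) (hxx : x < x') (hy : 2 ≤ y) (hyy : y ≤ y')
    (hy' : 2 < y') : f x' y' < f x y :=
  (f_lt_f_left hx hxx hy').trans_le <| by
    rw [f_comm x, f_comm x]; exact f_le_f_left hy hyy hx

theorem f_two_left {y : ℝ} (hy : 0 < y) : f 2 y = √(1 / 2) := by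
  unfold f
  congr 1
  field_simp
  ring

/-! ### Eccentricities in finite connected graphs. -/

section Eccentricity

variable {V : Type*} {G : SimpleGraph V}

/-- A function changing by at most one along edges bounds distances from below. -/
theorem le_add_dist_of_adj (hG : G.Connected) {φ : V → ℕ}
    (hφ : ∀ u v, G.Adj u v → φ u ≤ φ v + 1) (u v : V) : φ u ≤ φ v + G.dist u v := by
  obtain ⟨p, hp⟩ := hG.exists_walk_length_eq_dist u v
  rw [← hp]
  clear hp
  induction p with
  | nil => simp
  | cons hadj p ih =>
    rw [Walk.length_cons]
    have := hφ _ _ hadj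
    omega

variable [Finite V]

theorem coe_ecc (hG : G.Connected) (u : V) : (ecc G u : ℕ∞) = G.eccent u := by
  obtain ⟨v, hv⟩ := G.exists_edist_eq_eccent_of_finite u
  exact ENat.natCast_toNat (hv ▸ edist_ne_top_iff_reachable.2 (hG.preconnected u v))

theorem ecc_le_iff (hG : G.Connected) {u : V} {m : ℕ} : ecc G u ≤ m ↔ ∀ v, G.dist u v ≤ m := by
  rw [← Nat.cast_le (α := ℕ∞), coe_ecc hG, eccent_le_iff]
  refine forall_congr' fun v => ?_
  rw [← (hG.preconnected u v).coe_dist_eq_edist, Nat.cast_le]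

theorem dist_le_ecc (hG : G.Connected) (u v : V) : G.dist u v ≤ ecc G u :=
  (ecc_le_iff hG).1 le_rfl v

theorem ecc_le_succ_of_adj (hG : G.Connected) {u v : V} (huv : G.Adj u v) :
    ecc G u ≤ ecc G v + 1 := by
  refine (ecc_le_iff hG).2 fun w => ?_
  have h1 := hG.dist_triangle (u := u) (v := v) (w := w)
  rw [dist_eq_one_iff_adj.2 huv] at h1
  have := dist_le_ecc hG v w
  omega

end Eccentricity

/-- The eccentricity of the `i`-th vertex of a cycle of length `k` whose vertex number `0` carries
all the pendant vertices. -/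
def cycleEcc (k i : ℕ) : ℕ := max (k / 2) (1 + min i (k - i))

/-! ### Lower bounds for eccentricities. -/

namespace SunDecomp

variable {V : Type*} {G : SimpleGraph V} {k : ℕ} {c : ℕ → V} {r h : V → ℕ}

theorem root_succ (hs : SunDecomp G k c r h) {i : ℕ} (hi : i < k) :
    (i + 1 < k ∧ r (c (i + 1)) = i + 1) ∨ (i + 1 = k ∧ r (c (i + 1)) = 0) := by
  rcases (Nat.succ_le_of_lt hi).lt_or_eq with h1 | h1
  · exact .inl ⟨h1, hs.root_cycle _ h1⟩
  · refine .inr ⟨h1, ?_⟩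
    rw [← Nat.succ_eq_add_one, h1, hs.closed]
    exact hs.root_cycle _ (by omega)

theorem height_succ (hs : SunDecomp G k c r h) {i : ℕ} (hi : i < k) : h (c (i + 1)) = 0 := by
  rcases (Nat.succ_le_of_lt hi).lt_or_eq with h1 | h1
  · exact hs.height_cycle _ h1
  · rw [← Nat.succ_eq_add_one, h1, hs.closed]
    exact hs.height_cycle _ (by omega)

/-- The left side, as a function of `v`, changes by at most one along every edge and vanishes at `c
j`. -/
theorem add_cycleDist_le_dist (hs : SunDecomp G k c r h) (hG : G.Connected) (v : V) {j : ℕ}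
    (hj : j < k) : h v + cycleDist k (r v) j ≤ G.dist v (c j) := by
  have key := le_add_dist_of_adj hG (φ := fun v => h v + cycleDist k (r v) j) ?_ v (c j)
  · simpa [hs.height_cycle j hj, hs.root_cycle j hj, cycleDist] using key
  · intro u v huv
    rcases hs.edge u v huv with ⟨i, hi, he⟩ | ⟨h1, h2⟩
    · have a1 := hs.height_cycle i hi
      have a2 := hs.height_succ hi
      have a3 := hs.root_cycle i hi
      have a4 := hs.root_succ hi
      rw [Sym2.eq_iff] at he
      rcases he with ⟨rfl, rfl⟩ | ⟨rfl, rfl⟩ <;>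
        · simp only [a1, a2, a3, cycleDist]
          omega
    · simp only [h1]
      omega

variable [Finite V]

theorem height_add_le_ecc (hs : SunDecomp G k c r h) (hG : G.Connected) (v : V) :
    h v + k / 2 ≤ ecc G v := by
  have hv := hs.root_lt v
  -- The index `j` is antipodal to `r v` on the cycle.
  obtain ⟨j, hj, hd⟩ : ∃ j < k, cycleDist k (r v) j = k / 2 := by
    by_cases hlt : r v + k / 2 < k
    · exact ⟨r v + k / 2, hlt, by unfold cycleDist; omega⟩
    · exact ⟨r v - k / 2, by omega, by unfold cycleDist; omega⟩
  rw [← hd]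
  exact (hs.add_cycleDist_le_dist hG v hj).trans (dist_le_ecc hG _ _)

theorem height_add_cycleDist_le_ecc (hs : SunDecomp G k c r h) (hG : G.Connected) (v : V) {i : ℕ}
    (hi : i < k) : h v + cycleDist k (r v) i ≤ ecc G (c i) := by
  refine (hs.add_cycleDist_le_dist hG v hi).trans ?_
  rw [dist_comm]
  exact dist_le_ecc hG _ _

theorem cycleEcc_le_ecc (hs : SunDecomp G k c r h) (hG : G.Connected) {v : V} (hv : h v ≠ 0)
    (hrv : r v = 0) {i : ℕ} (hi : i ≤ k) : cycleEcc k i ≤ ecc G (c i) := by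
  have h3 := hs.three_le
  refine max_le ((Nat.le_add_left _ _).trans (hs.height_add_le_ecc hG _)) ?_
  -- The index `i = k` is allowed so that the closing edge from `c (k - 1)` to `c k = c 0` needs no
  -- reduction modulo `k`.
  rcases hi.lt_or_eq with h1 | rfl
  · have := hs.height_add_cycleDist_le_ecc hG v h1
    simp only [hrv, cycleDist] at this
    omega
  · rw [hs.closed]
    have := hs.height_add_cycleDist_le_ecc hG v (i := 0) (by omega)
    simp only [hrv, cycleDist] at this
    omega

end SunDecomp

/-! ### Splitting the index into cycle edges and tree edges. -/

section Sum

variable {V : Type*} {G : SimpleGraph V} {k : ℕ} {c : ℕ → V} {r h : V → ℕ}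

theorem SunDecomp.injOn_cycleEdge (hs : SunDecomp G k c r h) :
    Set.InjOn (fun i => s(c i, c (i + 1))) (Finset.range k) := by
  intro i hi j hj hij
  simp only [Finset.coe_range, Set.mem_Iio] at hi hj
  have h3 := hs.three_le
  have a1 := hs.root_cycle i hi
  have a2 := hs.root_cycle j hj
  have a3 := hs.root_succ hi
  have a4 := hs.root_succ hj
  rcases Sym2.eq_iff.1 hij with ⟨e1, e2⟩ | ⟨e1, e2⟩
  · exact hs.inj _ hi _ hj e1
  -- Opposite orientations would give `j = i + 1` and `i = j + 1` modulo `k`, impossible for `k ≥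
  -- 3`.
  · rw [e1] at a1
    rw [e2] at a3
    omega

open Classical in
/-- The edges of a decomposed graph that lie on its cycle. -/
noncomputable def cycleEdges (k : ℕ) (c : ℕ → V) : Finset (Sym2 V) :=
  (Finset.range k).image fun i => s(c i, c (i + 1))

theorem SunDecomp.card_cycleEdges (hs : SunDecomp G k c r h) : (cycleEdges k c).card = k := by
  classical
  rw [cycleEdges, Finset.card_image_of_injOn hs.injOn_cycleEdge, Finset.card_range]

theorem SunDecomp.sum_cycleEdges (hs : SunDecomp G k c r h) (g : Sym2 V → ℝ) :
    ∑ e ∈ cycleEdges k c, g e = ∑ i ∈ Finset.range k, g s(c i, c (i + 1)) := by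
  classical
  rw [cycleEdges, Finset.sum_image hs.injOn_cycleEdge]

theorem SunDecomp.cycleEdges_subset (hs : SunDecomp G k c r h) [Fintype G.edgeSet] :
    cycleEdges k c ⊆ G.edgeFinset := by
  classical
  intro e he
  obtain ⟨i, hi, rfl⟩ := Finset.mem_image.1 he
  exact mem_edgeFinset.2 (hs.adj i (Finset.mem_range.1 hi))

open Classical in
theorem SunDecomp.exists_of_mem_sdiff (hs : SunDecomp G k c r h) [Fintype G.edgeSet] {e : Sym2 V}
    (he : e ∈ G.edgeFinset \ cycleEdges k c) :
    ∃ u v, e = s(u, v) ∧ G.Adj u v ∧ r u = r v ∧ h u = h v + 1 := by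
  rw [Finset.mem_sdiff, mem_edgeFinset] at he
  induction e with
  | h u v =>
  rcases hs.edge u v he.1 with ⟨i, hi, hh⟩ | ⟨h1, h2 | h2⟩
  · exact absurd (Finset.mem_image.2 ⟨i, Finset.mem_range.2 hi, hh.symm⟩) he.2
  · exact ⟨u, v, rfl, he.1, h1, h2⟩
  · exact ⟨v, u, Sym2.eq_swap, Adj.symm he.1, h1.symm, h2⟩

open Classical in
theorem SunDecomp.mem_sdiff (hs : SunDecomp G k c r h) [Fintype G.edgeSet] {u v : V}
    (huv : G.Adj u v) (hu : h u ≠ 0) : s(u, v) ∈ G.edgeFinset \ cycleEdges k c := by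
  rw [Finset.mem_sdiff]
  refine ⟨mem_edgeFinset.2 huv, fun hmem => hu ?_⟩
  obtain ⟨i, hi, he⟩ := Finset.mem_image.1 hmem
  rw [Finset.mem_range] at hi
  rcases Sym2.eq_iff.1 he with ⟨rfl, -⟩ | ⟨-, rfl⟩
  · exact hs.height_cycle _ hi
  · exact hs.height_succ hi

open Classical in
theorem SunDecomp.ABC3_eq [Fintype V] (hs : SunDecomp G k c r h) :
    ABC3 G = ∑ i ∈ Finset.range k, f (ecc G (c i)) (ecc G (c (i + 1))) +
      ∑ e ∈ G.edgeFinset \ cycleEdges k c, edgeTerm G e := by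
  rw [ABC3, ← Finset.sum_sdiff hs.cycleEdges_subset, hs.sum_cycleEdges, add_comm]
  rfl

open Classical in
theorem SunDecomp.card_sdiff [Fintype V] (hs : SunDecomp G k c r h) (hG : IsUnicyclic G) :
    (G.edgeFinset \ cycleEdges k c).card = Fintype.card V - k := by
  rw [Finset.card_sdiff_of_subset hs.cycleEdges_subset, hs.card_cycleEdges, hG.card_edgeFinset]

end Sum

/-! ### Upper bounds for distances and eccentricities when all trees have height at most one. -/

namespace SunDecomp

variable {V : Type*} {G : SimpleGraph V} {k : ℕ} {c : ℕ → V} {r h : V → ℕ}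

theorem dist_cycle_le_sub (hs : SunDecomp G k c r h) (hG : G.Connected) {i j : ℕ} (hij : i ≤ j)
    (hj : j ≤ k) : G.dist (c i) (c j) ≤ j - i := by
  induction j, hij using Nat.le_induction with
  | base => simp
  | succ j hij ih =>
    have h1 := hG.dist_triangle (u := c i) (v := c j) (w := c (j + 1))
    rw [dist_eq_one_iff_adj.2 (hs.adj j (by omega))] at h1
    have := ih (by omega)
    omega

theorem dist_cycle_le (hs : SunDecomp G k c r h) (hG : G.Connected) {i j : ℕ} (hi : i < k)
    (hj : j < k) : G.dist (c i) (c j) ≤ cycleDist k i j := by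
  wlog hij : i ≤ j generalizing i j
  · rw [dist_comm]
    refine (this hj hi (by omega)).trans (le_of_eq ?_)
    unfold cycleDist; omega
  have h1 := hs.dist_cycle_le_sub hG hij hj.le
  have h2 := hs.dist_cycle_le_sub hG (Nat.zero_le i) hi.le
  have h3 := hs.dist_cycle_le_sub hG hj.le le_rfl
  have h4 := hG.dist_triangle (u := c i) (v := c 0) (w := c j)
  rw [hs.closed, dist_comm] at h3
  rw [G.dist_comm (u := c i) (v := c 0)] at h4
  unfold cycleDist; omega

theorem adj_cycle_of_height (hs : SunDecomp G k c r h) {v : V} (hv : h v = 1) :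
    G.Adj v (c (r v)) := by
  obtain ⟨w, hw, hr, hh⟩ := hs.descend v (by omega)
  rwa [← hr, ← hs.eq_of_height w (by omega)]

theorem dist_root_le (hs : SunDecomp G k c r h) {v : V} (hv : h v ≤ 1) :
    G.dist v (c (r v)) ≤ h v := by
  rcases Nat.le_one_iff_eq_zero_or_eq_one.1 hv with h0 | h1
  · rw [← hs.eq_of_height v h0, dist_self]; exact Nat.zero_le _
  · rw [h1, dist_eq_one_iff_adj.2 (hs.adj_cycle_of_height h1)]

theorem dist_le_add (hs : SunDecomp G k c r h) (hG : G.Connected) {u v : V} (hu : h u ≤ 1)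
    (hv : h v ≤ 1) : G.dist u v ≤ h u + cycleDist k (r u) (r v) + h v := by
  have h1 := hs.dist_root_le hu
  have h2 := hs.dist_root_le hv
  have h3 := hs.dist_cycle_le hG (hs.root_lt u) (hs.root_lt v)
  have h4 := hG.dist_triangle (u := u) (v := c (r u)) (w := v)
  have h5 := hG.dist_triangle (u := c (r u)) (v := c (r v)) (w := v)
  rw [dist_comm] at h2
  omega

theorem ecc_cycle_le [Finite V] (hs : SunDecomp G k c r h) (hG : G.Connected)
    (hP : ∀ v, h v ≠ 0 → h v = 1 ∧ r v = 0) {i : ℕ} (hi : i ≤ k) :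
    ecc G (c i) ≤ cycleEcc k i := by
  have h3 := hs.three_le
  wlog hik : i < k generalizing i
  · obtain rfl : i = k := by omega
    rw [hs.closed]
    refine (this (i := 0) (by omega) (by omega)).trans (le_of_eq ?_)
    unfold cycleEcc; omega
  refine (ecc_le_iff hG).2 fun v => ?_
  have h0 := hs.height_cycle i hik
  have hv := hP v
  have := hs.dist_le_add hG (u := c i) (v := v) (by omega) (by omega)
  rw [h0, hs.root_cycle i hik] at this
  have hr := hs.root_lt v
  unfold cycleDist at this
  unfold cycleEcc
  by_cases hv0 : h v = 0
  · omega
  · have := hv hv0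
    omega

theorem ecc_le_of_height [Finite V] (hs : SunDecomp G k c r h) (hG : G.Connected)
    (hP : ∀ v, h v ≠ 0 → h v = 1 ∧ r v = 0) {u : V} (hu : h u ≠ 0) : ecc G u ≤ k / 2 + 1 := by
  have h3 := hs.three_le
  refine (ecc_le_iff hG).2 fun v => ?_
  have hu' := hP u hu
  have hv := hP v
  have := hs.dist_le_add hG (u := u) (v := v) (by omega) (by omega)
  have hr := hs.root_lt v
  rw [hu'.1, hu'.2] at this
  unfold cycleDist at this
  by_cases hv0 : h v = 0
  · omega
  · have := hv hv0
    omega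

end SunDecomp

/-! ### The bound and its equality case for `k ≥ 4`. -/

/-- A pendant vertex at `c j` with `j ≠ 0` lifts an antipode of `c j` above its extremal
eccentricity. The bound by 3 at the other end of the edge is what `f_lt_f` needs; it is automatic
for `k ≥ 6` and fails for `k = 4`, `j = 2`. -/
theorem exists_cycleEcc_lt {k j : ℕ} (hk : 4 ≤ k) (hj : 0 < j) (hjk : j < k)
    (h42 : ¬ (k = 4 ∧ j = 2)) : ∃ i < k,
    (cycleEcc k i < 1 + cycleDist k j i ∧
      3 ≤ max (cycleEcc k (i + 1)) (1 + cycleDist k j (i + 1))) ∨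
    (cycleEcc k (i + 1) < 1 + cycleDist k j (i + 1) ∧
      3 ≤ max (cycleEcc k i) (1 + cycleDist k j i)) := by
  by_cases h6 : k < 6
  · interval_cases k <;> interval_cases j <;> first | omega | decide
  · have h3 : ∀ i, 3 ≤ cycleEcc k i := fun i => le_max_of_le_left (by omega)
    suffices h : ∃ i < k, cycleEcc k i < 1 + cycleDist k j i by
      obtain ⟨i, hi, hlt⟩ := h
      exact ⟨i, hi, .inl ⟨hlt, le_max_of_le_left (h3 _)⟩⟩
    by_cases hlt : j + k / 2 < k
    -- For odd `k` and `j = 1` the first antipode of `j` is also an antipode of `0`, where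
    -- `cycleEcc` is already `k / 2 + 1`; the second antipode is taken instead.
    · by_cases he : j + k / 2 = k / 2 + 1 ∧ k % 2 = 1
      · exact ⟨j + k / 2 + 1, by omega, by unfold cycleEcc cycleDist; omega⟩
      · exact ⟨j + k / 2, hlt, by unfold cycleEcc cycleDist; omega⟩
    · exact ⟨j - k / 2 - k % 2 + (if j = k / 2 then k % 2 else 0), by split_ifs <;> omega, by
        unfold cycleEcc cycleDist; split_ifs <;> omega⟩

namespace SunDecomp

variable {V : Type*} [Fintype V] {G : SimpleGraph V} {k : ℕ} {c : ℕ → V} {r h : V → ℕ}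

theorem edgeTerm_cycle_le (hs : SunDecomp G k c r h) (hG : G.Connected) (hk : 4 ≤ k) {v : V}
    (hv : h v ≠ 0) (hrv : r v = 0) {i : ℕ} (hi : i < k) :
    f (ecc G (c i)) (ecc G (c (i + 1))) ≤ f (cycleEcc k i) (cycleEcc k (i + 1)) := by
  have h2 : ∀ i, 2 ≤ cycleEcc k i := fun i => le_max_of_le_left (by omega)
  exact f_le_f (mod_cast h2 _) (mod_cast hs.cycleEcc_le_ecc hG hv hrv hi.le) (mod_cast h2 _)
    (mod_cast hs.cycleEcc_le_ecc hG hv hrv hi)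

open Classical in
theorem edgeTerm_tree_le (hs : SunDecomp G k c r h) (hG : G.Connected) (hk : 4 ≤ k)
    {e : Sym2 V} (he : e ∈ G.edgeFinset \ cycleEdges k c) :
    edgeTerm G e ≤ f ((k / 2 : ℕ) + 1) (k / 2 : ℕ) := by
  obtain ⟨u, v, rfl, -, -, hh⟩ := hs.exists_of_mem_sdiff he
  have h1 := hs.height_add_le_ecc hG u
  have h2 := hs.height_add_le_ecc hG v
  have h3 : 2 ≤ k / 2 := by omega
  have h3' : (2 : ℝ) ≤ (k / 2 : ℕ) := mod_cast h3
  change f (ecc G u) (ecc G v) ≤ _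
  refine f_le_f (by linarith) ?_ h3' (by norm_cast; omega)
  norm_cast; omega

theorem ABC3_le (hs : SunDecomp G k c r h) (hG : IsUnicyclic G) (hk : 4 ≤ k) {v : V}
    (hv : h v ≠ 0) (hrv : r v = 0) :
    ABC3 G ≤ ∑ i ∈ Finset.range k, f (cycleEcc k i) (cycleEcc k (i + 1)) +
      (Fintype.card V - k : ℕ) * f ((k / 2 : ℕ) + 1) (k / 2 : ℕ) := by
  classical
  rw [hs.ABC3_eq, ← hs.card_sdiff hG]
  refine add_le_add (Finset.sum_le_sum fun i hi =>
    hs.edgeTerm_cycle_le hG.1 hk hv hrv (Finset.mem_range.1 hi)) ?_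
  rw [← nsmul_eq_mul]
  exact Finset.sum_le_card_nsmul _ _ _ fun e he => hs.edgeTerm_tree_le hG.1 hk he

theorem ABC3_eq_iff (hs : SunDecomp G k c r h) (hG : IsUnicyclic G) (hk : 4 ≤ k) {v : V}
    (hv : h v ≠ 0) (hrv : r v = 0) :
    ABC3 G = ∑ i ∈ Finset.range k, f (cycleEcc k i) (cycleEcc k (i + 1)) +
      (Fintype.card V - k : ℕ) * f ((k / 2 : ℕ) + 1) (k / 2 : ℕ) ↔
      ∀ w, h w ≠ 0 → h w = 1 ∧ r w = 0 := by
  classical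
  have hb : ∀ i, 2 ≤ cycleEcc k i := fun i => le_max_of_le_left (by omega)
  have h3 : 2 ≤ k / 2 := by omega
  have h3' : (2 : ℝ) ≤ (k / 2 : ℕ) := mod_cast h3
  have hcyc := fun i hi => hs.edgeTerm_cycle_le hG.1 hk hv hrv (Finset.mem_range.1 hi) (i := i)
  have htree := fun e he => hs.edgeTerm_tree_le hG.1 hk he (e := e)
  rw [hs.ABC3_eq, ← hs.card_sdiff hG, ← nsmul_eq_mul, ← Finset.sum_const,
    add_eq_add_iff_eq_and_eq (Finset.sum_le_sum hcyc) (Finset.sum_le_sum htree),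
    Finset.sum_eq_sum_iff_of_le hcyc, Finset.sum_eq_sum_iff_of_le htree]
  constructor
  · rintro ⟨h1, h2⟩
    have hlow : ∀ w, h w ≠ 0 → h w = 1 := by
      intro w hw
      by_contra hw1
      obtain ⟨u, hadj, hr, hh⟩ := hs.descend w hw
      have e1 := h2 _ (hs.mem_sdiff hadj hw)
      have a1 := hs.height_add_le_ecc hG.1 w
      have a2 := hs.height_add_le_ecc hG.1 u
      -- Here `h w ≥ 2` and `h u ≥ 1`, so both eccentricities on this tree edge exceed those of the
      -- bound.
      have : f (ecc G u) (ecc G w) < f (k / 2 : ℕ) ((k / 2 : ℕ) + 1) := by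
        refine f_lt_f h3' ?_ (by linarith) ?_ ?_ <;> norm_cast <;> omega
      rw [f_comm, f_comm ((k / 2 : ℕ) : ℝ)] at this
      exact this.ne e1
    intro w hw
    refine ⟨hlow w hw, by_contra fun hr0 => ?_⟩
    have hecc : ∀ i ≤ k, 1 + cycleDist k (r w) i ≤ ecc G (c i) := by
      intro i hi
      rcases hi.lt_or_eq with hi | rfl
      · have := hs.height_add_cycleDist_le_ecc hG.1 w hi
        rwa [hlow w hw] at this
      · have := hs.height_add_cycleDist_le_ecc hG.1 w (i := 0) (by omega)
        rw [hlow w hw] at this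
        rw [hs.closed]
        refine le_trans (le_of_eq ?_) this
        have := hs.root_lt w
        unfold cycleDist; omega
    -- In this case every edge at `c 0` on the cycle may keep the value `√(1/2)`, because `f 2 y`
    -- does not depend on `y`. The pendant edge at `c 0` detects the loss: both its ends have
    -- eccentricity at least 3.
    by_cases h42 : k = 4 ∧ r w = 2
    · obtain ⟨rfl, hrw⟩ := h42
      have hv1 := hlow v hv
      have e1 := h2 _ (hs.mem_sdiff (hs.adj_cycle_of_height hv1) hv)
      rw [hrv] at e1
      have a1 := hs.height_add_le_ecc hG.1 v
      have a2 := hecc 0 (by omega)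
      rw [hrw] at a2
      have : cycleDist 4 2 0 = 2 := rfl
      have : f (ecc G (c 0)) (ecc G v) < f (4 / 2 : ℕ) ((4 / 2 : ℕ) + 1) := by
        refine f_lt_f h3' ?_ (by linarith) ?_ ?_ <;> norm_cast <;> omega
      rw [f_comm, f_comm ((4 / 2 : ℕ) : ℝ)] at this
      exact this.ne e1
    · obtain ⟨i, hi, hcase⟩ := exists_cycleEcc_lt hk (by omega) (hs.root_lt w) h42
      have e1 := h1 i (Finset.mem_range.2 hi)
      have a1 := hecc i hi.le
      have a2 := hecc (i + 1) hi
      have b1 := hs.cycleEcc_le_ecc hG.1 hv hrv hi.le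
      have b2 := hs.cycleEcc_le_ecc hG.1 hv hrv (i := i + 1) hi
      rcases hcase with ⟨d1, d2⟩ | ⟨d1, d2⟩
      · refine (f_lt_f (mod_cast hb i) ?_ (mod_cast hb (i + 1)) (mod_cast b2) ?_).ne e1 <;>
          norm_cast <;> omega
      · rw [f_comm, f_comm (cycleEcc k i : ℝ)] at e1
        refine (f_lt_f (mod_cast hb (i + 1)) ?_ (mod_cast hb i) (mod_cast b1) ?_).ne e1 <;>
          norm_cast <;> omega
  · intro hP
    have hc : ∀ i ≤ k, ecc G (c i) = cycleEcc k i := fun i hi =>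
      (hs.ecc_cycle_le hG.1 hP hi).antisymm (hs.cycleEcc_le_ecc hG.1 hv hrv hi)
    refine ⟨fun i hi => ?_, fun e he => ?_⟩
    · rw [Finset.mem_range] at hi
      rw [hc i hi.le, hc (i + 1) hi]
    · obtain ⟨u, w, rfl, -, hr, hh⟩ := hs.exists_of_mem_sdiff he
      have hu := hP u (by omega)
      have hw0 : h w = 0 := by omega
      have hw : w = c 0 := by rw [hs.eq_of_height w hw0, ← hr, hu.2]
      have a1 := hs.ecc_le_of_height hG.1 hP (u := u) (by omega)
      have a2 := hs.height_add_le_ecc hG.1 u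
      have a3 : ecc G u = k / 2 + 1 := by omega
      have a4 : ecc G w = k / 2 := by
        rw [hw, hc 0 (by omega)]; unfold cycleEcc; omega
      change f (ecc G u) (ecc G w) = _
      rw [a3, a4]; push_cast; rfl

end SunDecomp

/-! ### The bound and its equality case for `k = 3`. -/

theorem f_le_sqrt_half {x y : ℕ} (hx : 1 ≤ x) (hy : 1 ≤ y) (hxy : x ≤ y + 1) (hyx : y ≤ x + 1)
    (h3 : 3 ≤ x + y) : f x y ≤ √(1 / 2) ∧ (f x y = √(1 / 2) ↔ x ≤ 2 ∨ y ≤ 2) := by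
  by_cases hx2 : x ≤ 2
  · have : f x y = √(1 / 2) := by
      obtain rfl | rfl : x = 1 ∨ x = 2 := by omega
      · obtain rfl : y = 2 := by omega
        rw [f_comm]; exact f_two_left (by norm_num)
      · exact f_two_left (by norm_cast)
    exact ⟨this.le, iff_of_true this (.inl hx2)⟩
  · by_cases hy2 : y ≤ 2
    · obtain rfl : y = 2 := by omega
      have : f x (2 : ℕ) = √(1 / 2) := by
        rw [f_comm]; exact f_two_left (by norm_cast)
      exact ⟨this.le, iff_of_true this (.inr le_rfl)⟩
    · have : f x y < √(1 / 2) := by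
        rw [← f_two_left (y := 2) (by norm_num)]
        refine f_lt_f le_rfl ?_ le_rfl ?_ ?_ <;> norm_cast <;> omega
      exact ⟨this.le, iff_of_false this.ne (by omega)⟩

section Triangle

variable {V : Type*} [Fintype V] {G : SimpleGraph V} {c : ℕ → V} {r h : V → ℕ}

theorem SunDecomp.edgeTerm_triangle (hs : SunDecomp G 3 c r h) (hG : G.Connected) {v : V}
    (hv : h v ≠ 0) (hrv : r v = 0) {u w : V} (huw : G.Adj u w) :
    edgeTerm G s(u, w) ≤ √(1 / 2) ∧
      (edgeTerm G s(u, w) = √(1 / 2) ↔ ecc G u ≤ 2 ∨ ecc G w ≤ 2) := by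
  have h1 := hs.height_add_le_ecc hG u
  have h2 := hs.height_add_le_ecc hG w
  change f (ecc G u) (ecc G w) ≤ _ ∧ (f (ecc G u) (ecc G w) = _ ↔ _)
  refine f_le_sqrt_half (by omega) (by omega) (ecc_le_succ_of_adj hG huw)
    (ecc_le_succ_of_adj hG huw.symm) ?_
  rcases hs.edge u w huw with ⟨i, hi, he⟩ | ⟨-, hh⟩
  · have a1 := hs.cycleEcc_le_ecc hG hv hrv hi.le
    have a2 := hs.cycleEcc_le_ecc hG hv hrv (i := i + 1) hi
    unfold cycleEcc at a1 a2
    rcases Sym2.eq_iff.1 he with ⟨rfl, rfl⟩ | ⟨rfl, rfl⟩ <;> omega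
  · omega

theorem SunDecomp.ABC3_triangle_le (hs : SunDecomp G 3 c r h) (hG : IsUnicyclic G) {v : V}
    (hv : h v ≠ 0) (hrv : r v = 0) :
    ABC3 G ≤ Fintype.card V * √(1 / 2) ∧
      (ABC3 G = Fintype.card V * √(1 / 2) ↔ ∀ w, h w ≤ 1) := by
  classical
  have hle : ∀ e ∈ G.edgeFinset, edgeTerm G e ≤ √(1 / 2) := by
    intro e he
    induction e with
    | h u w => exact (hs.edgeTerm_triangle hG.1 hv hrv (mem_edgeFinset.1 he)).1
  have hsum : (Fintype.card V : ℝ) * √(1 / 2) = ∑ e ∈ G.edgeFinset, √(1 / 2) := by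
    rw [Finset.sum_const, nsmul_eq_mul, hG.card_edgeFinset]
  rw [hsum, ABC3]
  refine ⟨Finset.sum_le_sum hle, ?_⟩
  rw [Finset.sum_eq_sum_iff_of_le hle]
  constructor
  · intro heq w
    by_contra! hw
    -- A vertex `w` of height at least two is at distance at least three from the two cycle vertices
    -- other than its root.
    have key : ∀ i < 3, r w ≠ i → ¬ ecc G (c i) ≤ 2 := by
      intro i hi hne
      have := hs.height_add_cycleDist_le_ecc hG.1 w hi
      have := hs.root_lt w
      unfold cycleDist at *
      omega
    -- Equality on each edge of the triangle puts the root of `w` on that edge, but no vertex lies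
    -- on all three.
    have key' : ∀ i < 3, r w = i ∨ r w = (i + 1) % 3 := by
      intro i hi
      have hadj := hs.adj i hi
      have := (hs.edgeTerm_triangle hG.1 hv hrv hadj).2.1 (heq _ (mem_edgeFinset.2 hadj))
      by_contra! hne
      rcases this with h1 | h1
      · exact key i hi hne.1 h1
      · obtain hi' | rfl : i + 1 < 3 ∨ i = 2 := by omega
        · exact key (i + 1) hi' (by omega) h1
        · rw [hs.closed] at h1
          exact key 0 (by omega) hne.2 h1
    have h0 := key' 0 (by omega)
    have h1 := key' 1 (by omega)
    have h2 := key' 2 (by omega)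
    omega
  · intro hP e he
    have hecc : ∀ u, h u = 0 → ecc G u ≤ 2 := by
      intro u hu
      refine (ecc_le_iff hG.1).2 fun w => ?_
      have h1 := hs.dist_le_add hG.1 (hP u) (hP w)
      have h2 := hs.root_lt u
      have h3 := hs.root_lt w
      have h4 := hP w
      unfold cycleDist at h1
      omega
    induction e with
    | h u w =>
      have hadj : G.Adj u w := mem_edgeFinset.1 he
      refine (hs.edgeTerm_triangle hG.1 hv hrv hadj).2.2 ?_
      rcases hs.edge u w hadj with ⟨i, hi, he⟩ | ⟨-, hh⟩
      · have := hs.height_cycle i hi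
        rcases Sym2.eq_iff.1 he with ⟨rfl, rfl⟩ | ⟨rfl, rfl⟩
        · exact .inl (hecc _ this)
        · exact .inr (hecc _ this)
      · have h1 := hP u
        have h2 := hP w
        rcases hh with hh | hh
        · exact .inr (hecc _ (by omega))
        · exact .inl (hecc _ (by omega))

end Triangle

/-! ### Isomorphism with the graphs `H`. -/

theorem cycleGraph_adj_iff_val {k : ℕ} (hk : 3 ≤ k) (i j : Fin k) :
    (cycleGraph k).Adj i j ↔ (i : ℕ) + 1 = j ∨ (j : ℕ) + 1 = i ∨
      ((i : ℕ) = 0 ∧ (j : ℕ) + 1 = k) ∨ ((j : ℕ) = 0 ∧ (i : ℕ) + 1 = k) := by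
  have key : ∀ a b : Fin k, (a - b).val = 1 ↔ (b : ℕ) + 1 = a ∨ ((a : ℕ) = 0 ∧ (b : ℕ) + 1 = k) := by
    intro a b
    have ha := a.2
    have hb := b.2
    rw [Fin.sub_def]
    simp only
    rcases le_or_gt b.val a.val with h | h
    · rw [show k - b.val + a.val = (a.val - b.val) + k by omega, Nat.add_mod_right,
        Nat.mod_eq_of_lt (by omega)]
      omega
    · rw [Nat.mod_eq_of_lt (by omega)]
      omega
  rw [cycleGraph_adj', key, key]
  tauto

namespace SunDecomp

variable {V : Type*} {G : SimpleGraph V} {k : ℕ} {c : ℕ → V} {r h : V → ℕ}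

theorem edge_of_height (hs : SunDecomp G k c r h) {u v : V} (huv : G.Adj u v) (hu : h u ≠ 0) :
    r u = r v ∧ (h u = h v + 1 ∨ h v = h u + 1) := by
  rcases hs.edge u v huv with ⟨i, hi, he⟩ | h
  · exfalso
    rcases Sym2.eq_iff.1 he with ⟨rfl, -⟩ | ⟨rfl, -⟩
    · exact hu (hs.height_cycle _ hi)
    · exact hu (hs.height_succ hi)
  · exact h

theorem adj_cycle_iff (hs : SunDecomp G k c r h) (i j : Fin k) :
    G.Adj (c i) (c j) ↔ (cycleGraph k).Adj i j := by
  have h3 := hs.three_le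
  rw [cycleGraph_adj_iff_val h3]
  constructor
  · intro hadj
    have hi0 := hs.height_cycle i i.2
    have hj0 := hs.height_cycle j j.2
    have hi := hs.root_cycle i i.2
    have hj := hs.root_cycle j j.2
    rcases hs.edge _ _ hadj with ⟨l, hl, he⟩ | ⟨-, hh⟩
    · have a1 := hs.root_cycle l hl
      have a2 := hs.root_succ hl
      rcases Sym2.eq_iff.1 he with ⟨e1, e2⟩ | ⟨e1, e2⟩ <;>
        · rw [e1] at hi
          rw [e2] at hj
          omega
    · omega
  · rintro (hij | hij | ⟨h0, hk⟩ | ⟨h0, hk⟩)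
    · have := hs.adj i i.2
      rwa [hij] at this
    · have := hs.adj j j.2
      rw [hij] at this
      exact this.symm
    · have := hs.adj j j.2
      rw [hk, hs.closed] at this
      rw [h0]
      exact this.symm
    · have := hs.adj i i.2
      rw [hk, hs.closed] at this
      rwa [h0]

/-- The number `m i` counts the vertices of height one with root `i`. The last clause serves to show
which `m i` vanish when all roots are `0`. -/
theorem exists_iso [Fintype V] (hs : SunDecomp G k c r h) (hP : ∀ v, h v ≤ 1) :
    ∃ m : Fin k → ℕ, k + ∑ i, m i = Fintype.card V ∧ Nonempty (G ≃g H k m) ∧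
      ∀ i, m i ≠ 0 → ∃ v, h v ≠ 0 ∧ r v = i := by
  classical
  let m : Fin k → ℕ := fun i => Fintype.card {v // h v = 1 ∧ r v = i}
  let e : ∀ i : Fin k, {v // h v = 1 ∧ r v = i} ≃ Fin (m i) := fun i => Fintype.equivFin _
  let ψ : Fin k ⊕ (Σ i : Fin k, Fin (m i)) → V :=
    Sum.elim (fun i => c i) (fun x => ((e x.1).symm x.2).1)
  have hl0 : ∀ i : Fin k, h (ψ (.inl i)) = 0 := fun i => hs.height_cycle _ i.2
  have hlr : ∀ i : Fin k, r (ψ (.inl i)) = i := fun i => hs.root_cycle _ i.2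
  have hr1 : ∀ x, h (ψ (.inr x)) = 1 := fun x => ((e x.1).symm x.2).2.1
  have hrr : ∀ x, r (ψ (.inr x)) = x.1 := fun x => ((e x.1).symm x.2).2.2
  have hinj : Function.Injective ψ := by
    rintro (i | ⟨i, x⟩) (j | ⟨j, y⟩) hij
    · have := hlr i
      rw [hij, hlr] at this
      rw [Fin.ext this]
    · have := hl0 i
      rw [hij, hr1] at this
      omega
    · have := hr1 ⟨i, x⟩
      rw [hij, hl0] at this
      omega
    · have := hrr ⟨i, x⟩
      rw [hij, hrr] at this
      obtain rfl : j = i := Fin.ext this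
      have hxy : x = y := (e j).symm.injective (Subtype.ext hij)
      rw [hxy]
  have hsurj : Function.Surjective ψ := by
    intro v
    rcases Nat.le_one_iff_eq_zero_or_eq_one.1 (hP v) with h0 | h1
    · exact ⟨.inl ⟨r v, hs.root_lt v⟩, (hs.eq_of_height v h0).symm⟩
    · exact ⟨.inr ⟨⟨r v, hs.root_lt v⟩, e ⟨r v, hs.root_lt v⟩ ⟨v, h1, rfl⟩⟩, by simp [ψ]⟩
  let E := Equiv.ofBijective ψ ⟨hinj, hsurj⟩
  have hpend : ∀ (i : Fin k) x, G.Adj (ψ (.inl i)) (ψ (.inr x)) ↔ x.1 = i := by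
    intro i x
    constructor
    · intro hadj
      have := (hs.edge_of_height hadj.symm (by rw [hr1]; omega)).1
      rw [hrr, hlr] at this
      exact Fin.ext this
    · rintro rfl
      have := hs.adj_cycle_of_height (hr1 x)
      rw [hrr] at this
      exact this.symm
  refine ⟨m, ?_, ⟨Iso.symm ⟨E, ?_⟩⟩, fun i hi => ?_⟩
  · rw [← Fintype.card_congr E]
    simp
  · rintro (i | x) (j | y)
    · exact hs.adj_cycle_iff i j
    · exact hpend i y
    · exact (G.adj_comm _ _).trans (hpend j x)
    · refine iff_of_false (fun hadj => ?_) id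
      have := (hs.edge_of_height hadj (by rw [show E = ψ from rfl, hr1]; omega)).2
      have e1 := hr1 x
      have e2 := hr1 y
      rw [show (E : _ → V) = ψ from rfl] at this
      omega
  · obtain ⟨v, hv⟩ := Fintype.card_pos_iff.1 (Nat.pos_of_ne_zero hi)
    exact ⟨v, by omega, hv.2⟩

theorem exists_iso_allAtFirst [Fintype V] (hs : SunDecomp G k c r h)
    (hP : ∀ v, h v ≠ 0 → h v = 1 ∧ r v = 0) :
    Nonempty (G ≃g H k (allAtFirst k (Fintype.card V - k))) := by
  have h3 := hs.three_le
  obtain ⟨m, hm, hiso, hroot⟩ := hs.exists_iso fun v => by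
    by_contra hv; have := hP v; omega
  have hm0 : ∀ i : Fin k, (i : ℕ) ≠ 0 → m i = 0 := by
    intro i hi
    by_contra hmi
    obtain ⟨v, hv, hr⟩ := hroot i hmi
    exact hi (hr ▸ (hP v hv).2)
  have hsum : ∑ i, m i = m ⟨0, by omega⟩ :=
    Fintype.sum_eq_single _ fun i hi => hm0 i fun h0 => hi (Fin.ext h0)
  have : m = allAtFirst k (Fintype.card V - k) := by
    funext i
    unfold allAtFirst
    split_ifs with hi
    · rw [show i = ⟨0, by omega⟩ from Fin.ext hi]; omega
    · exact hm0 i hi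
  rwa [← this]

/-- A new vertex of `H` has a single neighbour, while `c i` has two distinct ones on the cycle. -/
theorem iso_apply_cycle (hs : SunDecomp G k c r h) {m : Fin k → ℕ} (φ : G ≃g H k m) {i : ℕ}
    (hi : i < k) : ∃ a, φ (c i) = .inl a := by
  have h3 := hs.three_le
  rcases hx : φ (c i) with a | x
  · exact ⟨a, rfl⟩
  exfalso
  have hnb : ∀ w, G.Adj (c i) w → φ w = .inl x.1 := by
    intro w hw
    have := φ.map_adj_iff.2 hw
    rw [hx] at this
    rcases hw' : φ w with b | y
    · rw [hw'] at this
      exact congrArg _ (show x.1 = b from this).symm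
    · rw [hw'] at this
      exact this.elim
  have e1 := hnb _ (hs.adj i hi)
  have h1 := hs.root_succ hi
  rcases Nat.eq_zero_or_pos i with rfl | hpos
  · have hadj := hs.adj (k - 1) (by omega)
    rw [Nat.sub_add_cancel (by omega), hs.closed] at hadj
    have e2 := hnb _ hadj.symm
    rw [φ.injective (e1.trans e2.symm), hs.root_cycle _ (by omega)] at h1
    omega
  · have hadj := hs.adj (i - 1) (by omega)
    rw [Nat.sub_add_cancel hpos] at hadj
    have e2 := hnb _ hadj.symm
    rw [φ.injective (e1.trans e2.symm), hs.root_cycle _ (by omega)] at h1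
    omega

/-- By injectivity and finiteness the cycle maps onto the cycle of `H`, so `v` maps to a pendant
vertex and is itself adjacent to the cycle. -/
theorem iso_apply_of_height (hs : SunDecomp G k c r h) {m : Fin k → ℕ} (φ : G ≃g H k m) {v : V}
    (hv : h v ≠ 0) : h v = 1 ∧ ∃ x, φ v = .inr x ∧ φ (c (r v)) = .inl x.1 := by
  choose g hg using fun i : Fin k => hs.iso_apply_cycle φ i.2
  have hinj : Function.Injective g := by
    intro i j hij
    refine Fin.ext (hs.inj i i.2 j j.2 (φ.injective ?_))
    rw [hg, hg, hij]
  have hsurj := Finite.surjective_of_injective hinj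
  rcases hx : φ v with a | x
  · obtain ⟨i, rfl⟩ := hsurj a
    rw [← hg, φ.injective.eq_iff] at hx
    rw [hx] at hv
    exact absurd (hs.height_cycle i i.2) hv
  · obtain ⟨i, hi⟩ := hsurj x.1
    have hadj : G.Adj v (c i) := by
      rw [← φ.map_adj_iff, hx, hg, hi]
      rfl
    have hr := hs.edge_of_height hadj hv
    rw [hs.root_cycle i i.2, hs.height_cycle i i.2] at hr
    exact ⟨by omega, x, rfl, by rw [hr.1, hg, hi]⟩

theorem height_of_iso (hs : SunDecomp G k c r h) {m : Fin k → ℕ} (φ : G ≃g H k m) (v : V) :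
    h v ≤ 1 := by
  by_contra hv
  have := (hs.iso_apply_of_height φ (v := v) (by omega)).1
  omega

theorem root_of_iso_allAtFirst (hs : SunDecomp G k c r h) {a : ℕ} (φ : G ≃g H k (allAtFirst k a))
    {v w : V} (hv : h v ≠ 0) (hrv : r v = 0) (hw : h w ≠ 0) : r w = 0 := by
  have hzero : ∀ x : Σ i : Fin k, Fin (allAtFirst k a i), (x.1 : ℕ) = 0 := by
    rintro ⟨i, x⟩
    by_contra hi
    have := x.2
    simp only [allAtFirst, if_neg hi] at this
    omega
  obtain ⟨-, x, -, hx⟩ := hs.iso_apply_of_height φ hv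
  obtain ⟨-, y, -, hy⟩ := hs.iso_apply_of_height φ hw
  rw [show x.1 = y.1 from Fin.ext ((hzero x).trans (hzero y).symm), ← hy,
    φ.injective.eq_iff] at hx
  rw [← hs.inj _ (hs.root_lt v) _ (hs.root_lt w) hx, hrv]

end SunDecomp

/-! ### Closed forms of the extremal sum, and the conclusion. -/

theorem sum_cycleEcc_even {k : ℕ} (hk : 4 ≤ k) (he : Even k) :
    ∑ i ∈ Finset.range k, f (cycleEcc k i) (cycleEcc k (i + 1)) =
      2 * f ((k : ℝ) / 2 + 1) ((k : ℝ) / 2) + ((k : ℝ) - 2) * f ((k : ℝ) / 2) ((k : ℝ) / 2) := by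
  obtain ⟨a, rfl⟩ := he
  have hcast : ((a + a : ℕ) : ℝ) / 2 = a := by push_cast; ring
  rw [hcast]
  have hterm : ∀ i ∈ Finset.range (a + a), f (cycleEcc (a + a) i) (cycleEcc (a + a) (i + 1)) =
      f a a + ((if i = a - 1 then f (a + 1) a - f a a else 0) +
        if i = a then f (a + 1) a - f a a else 0) := by
    intro i hi
    rw [Finset.mem_range] at hi
    -- Only the vertex antipodal to `0` exceeds `a`, so just its two edges, numbered `a - 1` and
    -- `a`, differ from `f a a`.
    have hval : ∀ j, cycleEcc (a + a) j = if j = a then a + 1 else a := by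
      intro j; unfold cycleEcc; split_ifs <;> omega
    rw [hval, hval]
    rcases eq_or_ne i a with rfl | h1
    · simp [show i ≠ i - 1 by omega]
    · rcases eq_or_ne i (a - 1) with rfl | h2
      · simp [show a - 1 + 1 = a by omega, h1, f_comm (a : ℝ) (a + 1)]
      · simp [h1, h2, show i + 1 ≠ a by omega]
  rw [Finset.sum_congr rfl hterm, Finset.sum_add_distrib, Finset.sum_add_distrib,
    Finset.sum_ite_eq', Finset.sum_ite_eq', if_pos (by simp; omega), if_pos (by simp; omega)]
  simp
  ring

theorem sum_cycleEcc_odd {k : ℕ} (hk : 4 ≤ k) (ho : Odd k) :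
    ∑ i ∈ Finset.range k, f (cycleEcc k i) (cycleEcc k (i + 1)) =
      2 * f (((k : ℝ) + 1) / 2) (((k : ℝ) - 1) / 2) +
          ((k : ℝ) - 3) * f (((k : ℝ) - 1) / 2) (((k : ℝ) - 1) / 2) +
          f (((k : ℝ) + 1) / 2) (((k : ℝ) + 1) / 2) := by
  obtain ⟨a, rfl⟩ := ho
  have hcast : (((2 * a + 1 : ℕ) : ℝ) - 1) / 2 = a := by push_cast; ring
  have hcast' : (((2 * a + 1 : ℕ) : ℝ) + 1) / 2 = a + 1 := by push_cast; ring
  rw [hcast, hcast']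
  have hterm : ∀ i ∈ Finset.range (2 * a + 1),
      f (cycleEcc (2 * a + 1) i) (cycleEcc (2 * a + 1) (i + 1)) =
      f a a + ((if i = a - 1 then f (a + 1) a - f a a else 0) +
        ((if i = a then f (a + 1) (a + 1) - f a a else 0) +
          if i = a + 1 then f (a + 1) a - f a a else 0)) := by
    intro i hi
    rw [Finset.mem_range] at hi
    -- The two antipodes of `0` exceed `a`: the edge joining them gives `f (a + 1) (a + 1)`, and the
    -- edge on either side gives `f (a + 1) a`.
    have hval : ∀ j, cycleEcc (2 * a + 1) j = if j = a ∨ j = a + 1 then a + 1 else a := by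
      intro j; unfold cycleEcc; split_ifs <;> omega
    rw [hval, hval]
    rcases eq_or_ne i a with rfl | h1
    · simp [show i ≠ i - 1 by omega]
    · rcases eq_or_ne i (a - 1) with rfl | h2
      · simp [show a - 1 + 1 = a by omega, h1, f_comm (a : ℝ) (a + 1), show a - 1 ≠ a + 1 by omega]
      · rcases eq_or_ne i (a + 1) with rfl | h3
        · simp [show a + 1 ≠ a - 1 by omega, show a + 1 + 1 ≠ a by omega]
        · simp [h1, h2, h3, show i + 1 ≠ a by omega]
  rw [Finset.sum_congr rfl hterm, Finset.sum_add_distrib, Finset.sum_add_distrib,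
    Finset.sum_add_distrib,
    Finset.sum_ite_eq', Finset.sum_ite_eq', Finset.sum_ite_eq', if_pos (by simp; omega),
    if_pos (by simp; omega), if_pos (by simp; omega)]
  simp
  ring

theorem SunDecomp.iso_allAtFirst_iff {V : Type*} [Fintype V] {G : SimpleGraph V} {k : ℕ}
    {c : ℕ → V} {r h : V → ℕ} (hs : SunDecomp G k c r h) {v : V} (hv : h v ≠ 0) (hrv : r v = 0) :
    (∀ w, h w ≠ 0 → h w = 1 ∧ r w = 0) ↔
      Nonempty (G ≃g H k (allAtFirst k (Fintype.card V - k))) :=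
  ⟨hs.exists_iso_allAtFirst, fun ⟨φ⟩ _ hw =>
    ⟨(hs.iso_apply_of_height φ hw).1, hs.root_of_iso_allAtFirst φ hv hrv hw⟩⟩

end ABCThree

theorem lemma2p5 {V : Type*} [Fintype V] (G : SimpleGraph V) (n k : ℕ)
    (hG : ABCThree.IsUnicyclic G) (hcard : Fintype.card V = n) (hgirth : G.girth = k)
    (hn : 6 ≤ n) (hkn : k < n) :
    (k = 3 →
      ABCThree.ABC3 G ≤ (n : ℝ) * Real.sqrt (1 / 2) ∧
      (ABCThree.ABC3 G = (n : ℝ) * Real.sqrt (1 / 2) ↔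
        ∃ m : Fin 3 → ℕ, 3 + ∑ i, m i = n ∧ Nonempty (G ≃g ABCThree.H 3 m))) ∧
    (4 ≤ k → Even k →
      ABCThree.ABC3 G ≤
        ((n : ℝ) - k + 2) * ABCThree.f ((k : ℝ) / 2 + 1) ((k : ℝ) / 2) +
          ((k : ℝ) - 2) * ABCThree.f ((k : ℝ) / 2) ((k : ℝ) / 2) ∧
      (ABCThree.ABC3 G =
        ((n : ℝ) - k + 2) * ABCThree.f ((k : ℝ) / 2 + 1) ((k : ℝ) / 2) +
          ((k : ℝ) - 2) * ABCThree.f ((k : ℝ) / 2) ((k : ℝ) / 2) ↔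
        Nonempty (G ≃g ABCThree.H k (ABCThree.allAtFirst k (n - k))))) ∧
    (4 ≤ k → Odd k →
      ABCThree.ABC3 G ≤
        ((n : ℝ) - k + 2) * ABCThree.f (((k : ℝ) + 1) / 2) (((k : ℝ) - 1) / 2) +
          ((k : ℝ) - 3) * ABCThree.f (((k : ℝ) - 1) / 2) (((k : ℝ) - 1) / 2) +
          ABCThree.f (((k : ℝ) + 1) / 2) (((k : ℝ) + 1) / 2) ∧
      (ABCThree.ABC3 G =
        ((n : ℝ) - k + 2) * ABCThree.f (((k : ℝ) + 1) / 2) (((k : ℝ) - 1) / 2) +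
          ((k : ℝ) - 3) * ABCThree.f (((k : ℝ) - 1) / 2) (((k : ℝ) - 1) / 2) +
          ABCThree.f (((k : ℝ) + 1) / 2) (((k : ℝ) + 1) / 2) ↔
        Nonempty (G ≃g ABCThree.H k (ABCThree.allAtFirst k (n - k))))) := by
  subst hcard
  obtain ⟨c, r, h, hs, v, hv, hrv⟩ := hG.exists_sunDecomp hgirth hkn
  refine ⟨?_, fun hk he => ?_, fun hk ho => ?_⟩
  · rintro rfl
    obtain ⟨h1, h2⟩ := hs.ABC3_triangle_le hG hv hrv
    refine ⟨h1, h2.trans ⟨fun hP => ?_, ?_⟩⟩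
    · obtain ⟨m, hm, hiso, -⟩ := hs.exists_iso hP
      exact ⟨m, hm, hiso⟩
    · rintro ⟨m, -, ⟨φ⟩⟩ w
      exact hs.height_of_iso φ w
  · have h1 := hs.ABC3_le hG hk hv hrv
    have h2 := hs.ABC3_eq_iff hG hk hv hrv
    have hhalf : ((k / 2 : ℕ) : ℝ) = (k : ℝ) / 2 := Nat.cast_div he.two_dvd (by norm_num)
    rw [hs.iso_allAtFirst_iff hv hrv] at h2
    rw [ABCThree.sum_cycleEcc_even hk he, hhalf, Nat.cast_sub hkn.le] at h1 h2
    rw [← h2]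
    constructor
    · linarith
    · constructor <;> intro heq <;> linarith
  · have h1 := hs.ABC3_le hG hk hv hrv
    have h2 := hs.ABC3_eq_iff hG hk hv hrv
    have hhalf : ((k / 2 : ℕ) : ℝ) = ((k : ℝ) - 1) / 2 := by
      obtain ⟨a, rfl⟩ := ho
      rw [show (2 * a + 1) / 2 = a by omega]
      push_cast; ring
    have hhalf' : ((k : ℝ) - 1) / 2 + 1 = ((k : ℝ) + 1) / 2 := by ring
    rw [hs.iso_allAtFirst_iff hv hrv] at h2
    rw [ABCThree.sum_cycleEcc_odd hk ho, hhalf, hhalf', Nat.cast_sub hkn.le] at h1 h2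
    rw [← h2]
    constructor
    · linarith
    · constructor <;> intro heq <;> linarith
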